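/- **Setting.** Let $\mathbb P$ be a probability measure on $\mathbb R^m$, $\alpha\in(0,1]$, and $C:\mathbb R^n\times\mathbb R^m\to\mathbb R^n$ measurable. For a real random variable $Z$ put $\operatorname{CVaR}_\alpha[Z]=\inf_{\eta\in\mathbb R}\{\eta+\alpha^{-1}\mathbb E[Z-\eta]^+\}$, and let $F:\mathbb R^n\to\mathbb R^n$ be given by $F_i(h)=\operatorname{CVaR}_\alpha[C_i(h,\xi)]$, $\xi\sim\mathbb P$. Assume that $F$ is continuous and strictly monotone, i.e. $(F(x)-F(y))^\top(x-y)>0$ for $x\ne y$. Let $A\in\mathbb R^{l\times n}$, $b\in\mathbb R^l$, let $q^1,\dots,q^s:\mathbb R^n\to\mathbb R$ be convex and continuously differentiable, and put $\mathcal H_{\rm aff}=\{h: Ah=b\}$, $\mathcal H_{\rm ineq}=\{h: q^i(h)\le 0\ \forall i\}$, $\mathcal H=\mathcal H_{\rm aff}\cap\mathcal H_{\rm ineq}$. Assume that $\mathcal H$ is nonempty and compact, and let $h^*$ be the solution of the variational inequality: $h^*\in\mathcal H$ and $(h-h^*)^\top F(h^*)\ge 0$ for all $h\in\mathcal H$.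 **Algorithm.** Let $L$ be the orthogonal projection onto $\ker A$ and $\Pi_{\mathcal H_{\rm ineq}}$ the Euclidean projection onto $\mathcal H_{\rm ineq}$. Given $h^0\in\mathcal H_{\rm aff}$, $c>0$, step-sizes $\gamma^k>0$ with $\sum_k\gamma^k=\infty$ and $\sum_k(\gamma^k)^2<\infty$, and sample sizes $N_k\in\mathbb N$, let $$h^{k+1}=h^k-\gamma^kL\Big(F(h^k)+c\big(h^k-\Pi_{\mathcal H_{\rm ineq}}(h^k)\big)+\widehat\beta^{N_k}\Big),\qquad \widehat\beta^{N_k}=\widehat F^{N_k}(h^k)-F(h^k),$$ where $\widehat F^{N_k}_i(h)=\inf_{t\in\mathbb R}\{t+(N_k\alpha)^{-1}\sum_{j=1}^{N_k}[C_i(h,\xi^k_j)-t]^+\}$ and the samples $\xi^k_j$ ($k\ge 0$, $1\le j\le N_k$) are i.i.d. with law $\mathbb P$. **Claim.** The iterates satisfy $h^k\in\mathcal H_{\rm aff}$ for all $k$. Moreover, for all $\epsilon>0$ and $B_{\rm traj}$ there is $c_\epsilon=c_\epsilon(B_{\rm traj})>0$, and for every $B_{\rm err}$ there is $N_\epsilon=N_\epsilon(B_{\rm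 traj},B_{\rm err})\in\mathbb N$, such that every run of the algorithm with $c\ge c_\epsilon$ and $N_k\ge N_\epsilon$ for all $k$ for which, with probability one, $\|h^k\|\le B_{\rm traj}$ and $\|\widehat\beta^{N_k}\|\le B_{\rm err}$ for all $k$, satisfies, with probability one, $$\limsup_{k\to\infty}\|h^k-h^*\|\le\epsilon .$$ The thresholds $c_\epsilon,N_\epsilon$ do not depend on the step-sizes, the initial point, the sequence $(N_k)$ or $c$. -/

import Mathlib

open MeasureTheory ProbabilityTheory Filter

noncomputable section

namespace CVaRVI

/-- `ℝⁿ` with its Euclidean norm. -/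
abbrev E (n : ℕ) : Type := EuclideanSpace ℝ (Fin n)

/-- Conditional value-at-risk at level `α` of `Z` under `P`:
`inf_η { η + α⁻¹ E[Z - η]⁺ }`. -/
def CVaR {X : Type*} [MeasurableSpace X] (P : Measure X) (α : ℝ) (Z : X → ℝ) : ℝ :=
  ⨅ η : ℝ, (η + α⁻¹ * ∫ x, max (Z x - η) 0 ∂P)

/-- Empirical estimate of the conditional value-at-risk from the `N` sample values `z`:
`inf_η { η + (N α)⁻¹ ∑ⱼ [zⱼ - η]⁺ }`. -/
def empCVaR (α : ℝ) {N : ℕ} (z : Fin N → ℝ) : ℝ :=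
  ⨅ η : ℝ, (η + ((N : ℝ) * α)⁻¹ * ∑ j, max (z j - η) 0)

/-- The map `F`, with components `F_i(h) = CVaR_α[C_i(h, ξ)]`, `ξ ∼ P`. -/
def cvarMap {n m : ℕ} (P : Measure (E m)) (α : ℝ) (C : E n → E m → E n) (h : E n) : E n :=
  WithLp.toLp 2 fun i => CVaR P α fun ξ => C h ξ i

/-- The estimator of `F(h)` built from the samples `x₁, …, x_N`; all components use the same
samples. -/
def empMap {n m : ℕ} (α : ℝ) (C : E n → E m → E n) {N : ℕ} (x : Fin N → E m) (h : E n) : E n :=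
  WithLp.toLp 2 fun i => empCVaR α fun j => C h (x j) i

/-- The estimation error at `h`: estimator minus `F(h)`. -/
def estError {n m : ℕ} (P : Measure (E m)) (α : ℝ) (C : E n → E m → E n) {N : ℕ}
    (x : Fin N → E m) (h : E n) : E n :=
  empMap α C x h - cvarMap P α C h

/-- The affine set `{h | A h = b}`. -/
def affSet {n l : ℕ} (A : Matrix (Fin l) (Fin n) ℝ) (b : E l) : Set (E n) :=
  {h | Matrix.toEuclideanLin A h = b}

/-- The set `{h | qⁱ(h) ≤ 0 for all i}`. -/
def ineqSet {n s : ℕ} (q : Fin s → E n → ℝ) : Set (E n) :=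
  {h | ∀ i, q i h ≤ 0}

/-- The feasible set `{h | A h = b, qⁱ(h) ≤ 0 for all i}`. -/
def feasSet {n l s : ℕ} (A : Matrix (Fin l) (Fin n) ℝ) (b : E l) (q : Fin s → E n → ℝ) :
    Set (E n) :=
  affSet A b ∩ ineqSet q

/-- The solution set of the variational inequality `VI(H, F)`. -/
def SOL {n : ℕ} (H : Set (E n)) (F : E n → E n) : Set (E n) :=
  {x | x ∈ H ∧ ∀ h ∈ H, 0 ≤ inner ℝ (h - x) (F x)}

/-- Strict monotonicity of a map on `ℝⁿ`. -/
def StrictlyMonotone {n : ℕ} (F : E n → E n) : Prop :=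
  ∀ x y, x ≠ y → 0 < inner ℝ (F x - F y) (x - y)

/-- The Euclidean projection `argmin_{y ∈ S} ‖x - y‖`
(the minimizer exists and is unique when `S` is nonempty, closed and convex). -/
def proj {n : ℕ} (S : Set (E n)) (x : E n) : E n :=
  Classical.epsilon fun y => y ∈ S ∧ ∀ z ∈ S, ‖x - y‖ ≤ ‖x - z‖

/-- The matrix `L`: orthogonal projection of `ℝⁿ` onto `ker A`. -/
def kerProj {n l : ℕ} (A : Matrix (Fin l) (Fin n) ℝ) : E n →L[ℝ] E n :=
  (LinearMap.ker (Matrix.toEuclideanLin A)).starProjection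

/-- The iterates of the subspace-constrained algorithm
`h^{k+1} = h^k - γ^k L (F(h^k) + c (h^k - Π_{ineq}(h^k)) + β^k)`, where `β^k` is the error of the
estimator built from the `N k` samples `x k` drawn at iteration `k`. -/
def subspaceIter {n m l s : ℕ} (P : Measure (E m)) (α : ℝ) (C : E n → E m → E n)
    (A : Matrix (Fin l) (Fin n) ℝ) (q : Fin s → E n → ℝ) (γ : ℕ → ℝ) (c : ℝ) (N : ℕ → ℕ)
    (x : (k : ℕ) → Fin (N k) → E m) (h0 : E n) : ℕ → E n
  | 0 => h0
  | k + 1 =>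
    subspaceIter P α C A q γ c N x h0 k
      - γ k • kerProj A
          (cvarMap P α C (subspaceIter P α C A q γ c N x h0 k)
            + c • (subspaceIter P α C A q γ c N x h0 k
                - proj (ineqSet q) (subspaceIter P α C A q γ c N x h0 k))
            + estError P α C (x k) (subspaceIter P α C A q γ c N x h0 k))

/-- The step-sizes are positive with `∑ γ^k = ∞` and `∑ (γ^k)² < ∞`. -/
def IsStepSize (γ : ℕ → ℝ) : Prop :=
  (∀ k, 0 < γ k) ∧ ¬ Summable γ ∧ Summable fun k => γ k ^ 2

/-- The samples `ξ k j`, `j < N k`, over all iterations `k`, are i.i.d. with law `P`. -/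
def IIDSamples {Ω : Type*} [MeasurableSpace Ω] (μ : Measure Ω) {m : ℕ} (P : Measure (E m))
    (N : ℕ → ℕ) (ξ : (k : ℕ) → Fin (N k) → Ω → E m) : Prop :=
  (∀ k j, Measurable (ξ k j)) ∧ (∀ k j, μ.map (ξ k j) = P) ∧
    iIndepFun (fun p : (k : ℕ) × Fin (N k) => ξ p.1 p.2) μ

end CVaRVI

end

/-!
Strict monotonicity makes `⟨h - h*, F h⟩` positive on the feasible set away from `h*`, and at the
other points of the affine set the penalty `c (h - Π h)` adds at least `c ‖h - Π h‖²`. By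
compactness, for `c` large the penalized field has inner product at least some `δ > 0` with `h - h*`
on the part of the affine set where `‖h‖ ≤ Btraj` and `‖h - h*‖ ≥ ε`.

The sampling error splits into its conditional mean given the past and a martingale difference.
A bounded estimator forces the costs to be bounded, CVaR is `α⁻¹`-Lipschitz for the Wasserstein
distance, and the empirical law of `N` bounded samples is on average `O(1/√N)` close to the true
one; so the conditional mean costs at most `δ / 2` of the drift once `N` is large. The martingale
differences, weighted by `γ`, have a convergent sum because `∑ γ² < ∞`.

Consequently `‖h - h*‖²` decreases, up to a convergent perturbation, at rate at least `γ δ` outside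
the ball of radius `ε`, and `∑ γ = ∞` drives it into that ball.
-/

namespace CVaRVI

open scoped Topology

section Projection

variable {n : ℕ} {S : Set (E n)}

lemma proj_mem_and_norm_sub_proj_le (hne : S.Nonempty) (hcl : IsClosed S) (x : E n) :
    proj S x ∈ S ∧ ∀ z ∈ S, ‖x - proj S x‖ ≤ ‖x - z‖ := by
  obtain ⟨y, hy, hxy⟩ := hcl.exists_infDist_eq_dist hne x
  refine Classical.epsilon_spec (p := fun y => y ∈ S ∧ ∀ z ∈ S, ‖x - y‖ ≤ ‖x - z‖)
    ⟨y, hy, fun z hz => ?_⟩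
  rw [← dist_eq_norm, ← dist_eq_norm, ← hxy]
  exact Metric.infDist_le_dist_of_mem hz

lemma proj_mem (hne : S.Nonempty) (hcl : IsClosed S) (x : E n) : proj S x ∈ S :=
  (proj_mem_and_norm_sub_proj_le hne hcl x).1

lemma inner_sub_proj_sub_proj_nonpos (hcl : IsClosed S) (hconv : Convex ℝ S) (x : E n) {z : E n}
    (hz : z ∈ S) : inner ℝ (x - proj S x) (z - proj S x) ≤ 0 := by
  obtain ⟨hmem, hmin⟩ := proj_mem_and_norm_sub_proj_le ⟨z, hz⟩ hcl x
  refine (norm_eq_iInf_iff_real_inner_le_zero hconv hmem).1 ?_ z hz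
  have : Nonempty S := ⟨⟨z, hz⟩⟩
  refine le_antisymm (le_ciInf fun w => hmin w w.2) ?_
  exact ciInf_le ⟨0, by rintro _ ⟨w, rfl⟩; exact norm_nonneg _⟩ (⟨_, hmem⟩ : S)

lemma sq_norm_sub_proj_le_inner (hcl : IsClosed S) (hconv : Convex ℝ S) (x : E n) {z : E n}
    (hz : z ∈ S) : ‖x - proj S x‖ ^ 2 ≤ inner ℝ (x - z) (x - proj S x) := by
  have hobtuse := inner_sub_proj_sub_proj_nonpos hcl hconv x hz
  have hsplit : x - z = (x - proj S x) - (z - proj S x) := by abel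
  rw [hsplit, inner_sub_left, real_inner_self_eq_norm_sq, real_inner_comm]
  linarith

lemma lipschitzWith_proj (hne : S.Nonempty) (hcl : IsClosed S) (hconv : Convex ℝ S) :
    LipschitzWith 1 (proj S) := by
  refine LipschitzWith.of_dist_le_mul fun x y => ?_
  rw [NNReal.coe_one, one_mul, dist_eq_norm, dist_eq_norm]
  have hx := inner_sub_proj_sub_proj_nonpos hcl hconv x (proj_mem hne hcl y)
  have hy := inner_sub_proj_sub_proj_nonpos hcl hconv y (proj_mem hne hcl x)
  set p := proj S x
  set r := proj S y
  have hsum : inner ℝ (x - p) (r - p) + inner ℝ (y - r) (p - r)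
      = ‖p - r‖ ^ 2 - inner ℝ (x - y) (p - r) := by
    rw [← real_inner_self_eq_norm_sq, ← neg_sub p r, inner_neg_right,
      show y - r = (x - p) - (x - y) + (p - r) by abel, inner_add_left, inner_sub_left (x - p)]
    ring
  have hcs := real_inner_le_norm (x - y) (p - r)
  by_contra! hlt
  nlinarith [norm_nonneg (x - y), norm_nonneg (p - r)]

end Projection

section FeasibleSet

variable {n l s : ℕ} {A : Matrix (Fin l) (Fin n) ℝ} {b : E l} {q : Fin s → E n → ℝ}

lemma isClosed_affSet : IsClosed (affSet A b) :=
  isClosed_eq (LinearMap.continuous_of_finiteDimensional _) continuous_const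

lemma convex_ineqSet (hq : ∀ i, ConvexOn ℝ Set.univ (q i)) : Convex ℝ (ineqSet q) := by
  simp only [ineqSet, Set.ofPred_forall]
  exact convex_iInter fun i => by simpa using (hq i).convex_le 0

lemma isClosed_ineqSet (hq : ∀ i, ConvexOn ℝ Set.univ (q i)) : IsClosed (ineqSet q) := by
  simp only [ineqSet, Set.ofPred_forall]
  exact isClosed_iInter fun i => isClosed_le (hq i).locallyLipschitz.continuous continuous_const

lemma sub_mem_ker {x y : E n} (hx : x ∈ affSet A b) (hy : y ∈ affSet A b) :
    x - y ∈ LinearMap.ker (Matrix.toEuclideanLin A) := by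
  rw [LinearMap.mem_ker, map_sub, Set.mem_ofPred.1 hx, Set.mem_ofPred.1 hy, sub_self]

lemma subspaceIter_mem_affSet {m : ℕ} {P : Measure (E m)} {α : ℝ} {C : E n → E m → E n}
    {γ : ℕ → ℝ} {c : ℝ} {N : ℕ → ℕ} (x : (k : ℕ) → Fin (N k) → E m) {h0 : E n}
    (hh0 : h0 ∈ affSet A b) (k : ℕ) : subspaceIter P α C A q γ c N x h0 k ∈ affSet A b := by
  induction k with
  | zero => exact hh0
  | succ k ih =>
    have hker (v : E n) : Matrix.toEuclideanLin A (kerProj A v) = 0 :=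
      LinearMap.mem_ker.1 (Submodule.starProjection_apply_mem _ v)
    rw [affSet, Set.mem_ofPred] at ih ⊢
    rw [subspaceIter, map_sub, map_smul, hker, ih, smul_zero, sub_zero]

end FeasibleSet

section Penalty

lemma exists_penalty_forall_le {X : Type*} [TopologicalSpace X] {K : Set X} (hK : IsCompact K)
    {g d : X → ℝ} (hg : Continuous g) (hd : Continuous d) (hd0 : ∀ x, 0 ≤ d x)
    (hpos : ∀ x ∈ K, d x = 0 → 0 < g x) :
    ∃ c₀ : ℝ, 0 < c₀ ∧ ∃ δ : ℝ, 0 < δ ∧ ∀ c, c₀ ≤ c → ∀ x ∈ K, δ ≤ g x + c * d x := by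
  have hopen (j : ℕ) : IsOpen {x | 0 < g x + j * d x} :=
    isOpen_lt continuous_const (hg.add (continuous_const.mul hd))
  have hmono : Monotone fun j : ℕ => {x | 0 < g x + j * d x} := by
    intro i j hij x (hx : 0 < g x + i * d x)
    have : (i : ℝ) * d x ≤ j * d x := by gcongr; exact hd0 x
    exact hx.trans_le (by gcongr)
  have hcover : K ⊆ ⋃ j : ℕ, {x | 0 < g x + j * d x} := by
    intro x hx
    rw [Set.mem_iUnion]
    rcases (hd0 x).eq_or_lt with hzero | hdpos
    · exact ⟨0, by simpa using hpos x hx hzero.symm⟩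
    · obtain ⟨j, hj⟩ := exists_nat_gt (-g x / d x)
      rw [div_lt_iff₀ hdpos] at hj
      exact ⟨j, Set.mem_ofPred.2 (by linarith)⟩
  obtain ⟨j, hj⟩ := hK.elim_directed_cover _ hopen hcover hmono.directed_le
  obtain ⟨δ, hδ, hδle⟩ := hK.exists_forall_le' (hg.add (continuous_const.mul hd)).continuousOn hj
  refine ⟨j + 1, by positivity, δ, hδ, fun c hc x hx => (hδle x hx).trans ?_⟩
  have : (j : ℝ) * d x ≤ c * d x := mul_le_mul_of_nonneg_right (by linarith) (hd0 x)
  simpa using this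

/-- `x` is a strict solution of the Minty variational inequality for `F` on `H`: seen from every
other point of `H`, the field `-F` points towards `x`. It is the form in which monotonicity enters
the descent estimates. -/
def IsStrictMintySolution {n : ℕ} (H : Set (E n)) (F : E n → E n) (x : E n) : Prop :=
  x ∈ H ∧ ∀ h ∈ H, h ≠ x → 0 < inner ℝ (h - x) (F h)

lemma StrictlyMonotone.isStrictMintySolution {n : ℕ} {H : Set (E n)} {F : E n → E n}
    (hF : StrictlyMonotone F) {x : E n} (hx : x ∈ SOL H F) : IsStrictMintySolution H F x := by
  refine ⟨hx.1, fun h hh hne => ?_⟩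
  have hmono := hF h x hne
  rw [real_inner_comm, inner_sub_right] at hmono
  linarith [hx.2 h hh]

lemma IsStrictMintySolution.exists_penalty_inner_ge {n l s : ℕ} {A : Matrix (Fin l) (Fin n) ℝ}
    {b : E l} {q : Fin s → E n → ℝ} {F : E n → E n} {x : E n}
    (hx : IsStrictMintySolution (feasSet A b q) F x) (hF : Continuous F)
    (hq : ∀ i, ConvexOn ℝ Set.univ (q i)) {ε : ℝ} (hε : 0 < ε) (R : ℝ) :
    ∃ c₀ : ℝ, 0 < c₀ ∧ ∃ δ : ℝ, 0 < δ ∧ ∀ c, c₀ ≤ c → ∀ h ∈ affSet A b, ‖h‖ ≤ R →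
      ε ≤ ‖h - x‖ → δ ≤ inner ℝ (h - x) (F h + c • (h - proj (ineqSet q) h)) := by
  obtain ⟨hxH, hpos⟩ := hx
  have hcl := isClosed_ineqSet hq
  have hne : (ineqSet q).Nonempty := ⟨x, hxH.2⟩
  have hproj := (lipschitzWith_proj hne hcl (convex_ineqSet hq)).continuous
  have hcompact : IsCompact ((affSet A b ∩ {h | ε ≤ ‖h - x‖}) ∩ Metric.closedBall 0 R) :=
    (isCompact_closedBall 0 R).inter_left
      (isClosed_affSet.inter (isClosed_le (by fun_prop) (by fun_prop)))
  have hposK : ∀ h ∈ (affSet A b ∩ {h | ε ≤ ‖h - x‖}) ∩ Metric.closedBall 0 R,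
      ‖h - proj (ineqSet q) h‖ ^ 2 = 0 → 0 < inner ℝ (h - x) (F h) := by
    rintro h ⟨⟨hA, hfar⟩, -⟩ hdist
    have hfix : h = proj (ineqSet q) h := by simpa [sub_eq_zero] using hdist
    refine hpos h ⟨hA, hfix ▸ proj_mem hne hcl h⟩ fun heq => hε.not_ge ?_
    simpa [heq] using hfar
  obtain ⟨c₀, hc₀, δ, hδ, hle⟩ := exists_penalty_forall_le hcompact
    (g := fun h => inner ℝ (h - x) (F h)) (d := fun h => ‖h - proj (ineqSet q) h‖ ^ 2)
    (by fun_prop) (by fun_prop) (fun h => sq_nonneg _) hposK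
  refine ⟨c₀, hc₀, δ, hδ, fun c hc h hA hR hfar => ?_⟩
  calc δ ≤ inner ℝ (h - x) (F h) + c * ‖h - proj (ineqSet q) h‖ ^ 2 :=
        hle c hc h ⟨⟨hA, hfar⟩, by simpa using hR⟩
    _ ≤ inner ℝ (h - x) (F h) + c * inner ℝ (h - x) (h - proj (ineqSet q) h) := by
        gcongr
        · linarith
        · exact sq_norm_sub_proj_le_inner hcl (convex_ineqSet hq) h hxH.2
    _ = inner ℝ (h - x) (F h + c • (h - proj (ineqSet q) h)) := by
        rw [inner_add_right, inner_smul_right]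

end Penalty

section Descent

variable {V W a γ S : ℕ → ℝ} {r δ M η : ℝ}

lemma frequently_lt_of_descent (hγ : ∀ k, 0 ≤ γ k) (hγs : ¬ Summable γ)
    (hstep : ∀ k, W (k + 1) ≤ W k - γ k * a k) (hδ : 0 < δ)
    (ha : ∀ᶠ k in atTop, r ≤ W k → δ ≤ a k) : ∃ᶠ k in atTop, W k < r := by
  intro hcon
  obtain ⟨K, hK⟩ := eventually_atTop.1 (ha.and hcon)
  have hr (i : ℕ) : r ≤ W (i + K) := not_lt.1 (hK _ le_add_self).2
  have htelescope (i : ℕ) : δ * ∑ j ∈ Finset.range i, γ (j + K) ≤ W K - W (i + K) := by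
    induction i with
    | zero => simp
    | succ i ih =>
      have hdec := mul_le_mul_of_nonneg_left ((hK _ le_add_self).1 (hr i)) (hγ (i + K))
      have hnext := hstep (i + K)
      rw [Finset.sum_range_succ, mul_add, Nat.add_right_comm]
      linarith
  refine hγs ((summable_nat_add_iff K).1 ?_)
  refine summable_of_sum_range_le (c := (W K - r) / δ) (fun i => hγ _) fun i => ?_
  rw [le_div_iff₀' hδ]
  linarith [htelescope i, hr i]

lemma eventually_le_of_descent (hγ : ∀ k, 0 ≤ γ k) (hγ0 : Tendsto γ atTop (𝓝 0))
    (hγs : ¬ Summable γ) (hstep : ∀ k, W (k + 1) ≤ W k - γ k * a k) (hM : ∀ k, -M ≤ a k)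
    (hδ : 0 < δ) (ha : ∀ᶠ k in atTop, r ≤ W k → δ ≤ a k) (hη : 0 < η) :
    ∀ᶠ k in atTop, W k ≤ r + η := by
  have hsmall : ∀ᶠ k in atTop, γ k * M < η :=
    (by simpa using hγ0.mul_const M : Tendsto (fun k => γ k * M) atTop (𝓝 0)).eventually_lt_const hη
  obtain ⟨K, hK⟩ := eventually_atTop.1 (ha.and hsmall)
  obtain ⟨k₀, hKk₀, hk₀⟩ :=
    (frequently_atTop.1 (frequently_lt_of_descent hγ hγs hstep hδ ha)) K
  filter_upwards [eventually_ge_atTop k₀] with k hk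
  induction k, hk using Nat.le_induction with
  | base => linarith
  | succ k hk ih =>
    obtain ⟨hdrift, hγM⟩ := hK k (hKk₀.trans hk)
    rcases le_or_gt r (W k) with hr | hr
    · have := mul_nonneg (hγ k) (hδ.le.trans (hdrift hr))
      linarith [hstep k]
    · have := mul_le_mul_of_nonneg_left (hM k) (hγ k)
      linarith [hstep k]

lemma eventually_le_of_perturbed_descent {L : ℝ} (hγ : ∀ k, 0 ≤ γ k)
    (hγ0 : Tendsto γ atTop (𝓝 0)) (hγs : ¬ Summable γ) (hS : Tendsto S atTop (𝓝 L))
    (hstep : ∀ k, V (k + 1) ≤ V k - γ k * a k + (S (k + 1) - S k)) (hM : ∀ k, -M ≤ a k)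
    (hδ : 0 < δ) (ha : ∀ k, r ≤ V k → δ ≤ a k) (hη : 0 < η) : ∀ᶠ k in atTop, V k ≤ r + η := by
  have hnear : ∀ᶠ k in atTop, |S k - L| < η / 3 := by
    simpa [Real.dist_eq] using Metric.tendsto_nhds.1 hS (η / 3) (by positivity)
  have hdrift : ∀ᶠ k in atTop, r - L + η / 3 ≤ V k - S k → δ ≤ a k := by
    filter_upwards [hnear] with k hk hr
    exact ha k (by linarith [(abs_lt.1 hk).1])
  -- `V - S` satisfies the unperturbed recursion.
  have hdescent := eventually_le_of_descent (W := fun k => V k - S k) hγ hγ0 hγs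
    (fun k => by linarith [hstep k]) hM hδ hdrift (show 0 < η / 3 by positivity)
  filter_upwards [hdescent, hnear] with k hle hk
  linarith [(abs_lt.1 hk).2]

end Descent

section RobbinsMonro

lemma IsStepSize.tendsto_zero {γ : ℕ → ℝ} (hγ : IsStepSize γ) : Tendsto γ atTop (𝓝 0) := by
  have := hγ.2.2.tendsto_atTop_zero.sqrt
  simpa [Real.sqrt_sq (hγ.1 _).le] using this

variable {H : Type*} [NormedAddCommGroup H] [InnerProductSpace ℝ H] {K : Submodule ℝ H}
  [K.HasOrthogonalProjection]

lemma sq_norm_sub_smul_starProjection_sub_le {x z : H} (hxz : x - z ∈ K) (t : ℝ) (w : H) :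
    ‖x - t • K.starProjection w - z‖ ^ 2
      ≤ ‖x - z‖ ^ 2 - 2 * t * inner ℝ (x - z) w + t ^ 2 * ‖w‖ ^ 2 := by
  have hinner : inner ℝ (x - z) (K.starProjection w) = inner ℝ (x - z) w := by
    rw [← Submodule.inner_starProjection_left_eq_right, Submodule.starProjection_eq_self_iff.2 hxz]
  have hnorm : ‖K.starProjection w‖ ^ 2 ≤ ‖w‖ ^ 2 := by
    gcongr; exact K.norm_starProjection_apply_le w
  rw [sub_right_comm, norm_sub_sq_real, inner_smul_right, hinner, norm_smul, mul_pow,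
    Real.norm_eq_abs, sq_abs]
  linarith [mul_le_mul_of_nonneg_left hnorm (sq_nonneg t)]

lemma limsup_norm_sub_le_of_robbinsMonro {x w : ℕ → H} {z : H} {γ a : ℕ → ℝ} {ε δ M R L : ℝ}
    (hγ : IsStepSize γ) (hrec : ∀ k, x (k + 1) = x k - γ k • K.starProjection (w k))
    (hxz : ∀ k, x k - z ∈ K) (hw : ∀ k, ‖w k‖ ≤ R) (hM : ∀ k, -M ≤ a k) (hε : 0 < ε) (hδ : 0 < δ)
    (ha : ∀ k, ε ≤ ‖x k - z‖ → δ ≤ a k)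
    (hnoise : Tendsto (fun k => ∑ i ∈ Finset.range k, γ i * (inner ℝ (x i - z) (w i) - a i))
      atTop (𝓝 L)) :
    limsup (fun k => ‖x k - z‖) atTop ≤ ε := by
  let S : ℕ → ℝ := fun k =>
    -2 * (∑ i ∈ Finset.range k, γ i * (inner ℝ (x i - z) (w i) - a i))
      + (∑ i ∈ Finset.range k, γ i ^ 2) * R ^ 2
  have hS : Tendsto S atTop (𝓝 (-2 * L + (∑' i, γ i ^ 2) * R ^ 2)) :=
    (hnoise.const_mul _).add (hγ.2.2.hasSum.tendsto_sum_nat.mul_const _)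
  have hstep (k : ℕ) : ‖x (k + 1) - z‖ ^ 2
      ≤ ‖x k - z‖ ^ 2 - γ k * (2 * a k) + (S (k + 1) - S k) := by
    have hbound := sq_norm_sub_smul_starProjection_sub_le (hxz k) (γ k) (w k)
    have hwR : γ k ^ 2 * ‖w k‖ ^ 2 ≤ γ k ^ 2 * R ^ 2 := by gcongr; exact hw k
    simp only [S, Finset.sum_range_succ]
    rw [hrec]
    linarith
  have hdrift (k : ℕ) (hk : ε ^ 2 ≤ ‖x k - z‖ ^ 2) : 2 * δ ≤ 2 * a k := by
    have := ha k ((pow_le_pow_iff_left₀ hε.le (norm_nonneg _) two_ne_zero).1 hk)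
    linarith
  refine le_of_forall_gt_imp_ge_of_dense fun t ht => ?_
  refine limsup_le_of_le (isCoboundedUnder_le_of_le atTop fun k => norm_nonneg _) ?_
  have hη : 0 < t ^ 2 - ε ^ 2 := sub_pos.2 (pow_lt_pow_left₀ ht hε.le two_ne_zero)
  filter_upwards [eventually_le_of_perturbed_descent (fun k => (hγ.1 k).le) hγ.tendsto_zero hγ.2.1
    hS hstep (fun k => show -(2 * M) ≤ _ by linarith [hM k]) (by positivity) hdrift hη] with k hk
  rw [add_sub_cancel] at hk
  exact (pow_le_pow_iff_left₀ (norm_nonneg _) (hε.trans ht).le two_ne_zero).1 hk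

end RobbinsMonro

section Survival

variable {X : Type*} [MeasurableSpace X] {P : Measure X} [IsFiniteMeasure P] {Z : X → ℝ} {hi : ℝ}

lemma integral_max_sub_eq_setIntegral_survival (hZ : Integrable Z P)
    (hle : ∀ᵐ x ∂P, Z x ≤ hi) (η : ℝ) :
    ∫ x, max (Z x - η) 0 ∂P = ∫ t in Set.Ioc η hi, P.real {x | t < Z x} := by
  have hexcess : Integrable (fun x => max (Z x - η) 0) P := (hZ.sub (integrable_const η)).pos_part
  have hzero (t : ℝ) (ht : t ∈ Set.Ioi η \ Set.Ioc η hi) : P.real {x | t < Z x} = 0 := by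
    have hhi : hi < t := not_le.1 fun h => ht.2 ⟨ht.1, h⟩
    rw [measureReal_eq_zero_iff, measure_eq_zero_iff_ae_notMem]
    filter_upwards [hle] with x hx using (hx.trans hhi.le).not_gt
  calc ∫ x, max (Z x - η) 0 ∂P
      = ∫ t in Set.Ioi 0, P.real {x | t < max (Z x - η) 0} :=
        hexcess.integral_eq_integral_meas_lt (ae_of_all _ fun x => le_max_right _ _)
    _ = ∫ t in Set.Ioi 0, P.real {x | t + η < Z x} := by
        refine setIntegral_congr_fun measurableSet_Ioi fun t (ht : 0 < t) => ?_
        simp [lt_sub_iff_add_lt, ht.not_gt]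
    _ = ∫ t in Set.Ioi η, P.real {x | t < Z x} := by
        simpa using (measurePreserving_add_right volume η).setIntegral_preimage_emb
          (measurableEmbedding_addRight η) (fun t => P.real {x | t < Z x}) (Set.Ioi η)
    _ = ∫ t in Set.Ioc η hi, P.real {x | t < Z x} :=
        setIntegral_eq_of_subset_of_forall_sdiff_eq_zero measurableSet_Ioi
          Set.Ioc_subset_Ioi_self hzero

lemma antitone_survival : Antitone fun t => P.real {x | t < Z x} :=
  fun _ _ hst => measureReal_mono fun _ hx => hst.trans_lt hx

lemma integrableOn_survival {s : Set ℝ} {a b : ℝ} (hs : s ⊆ Set.Icc a b) :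
    IntegrableOn (fun t => P.real {x | t < Z x}) s :=
  ((antitone_survival.antitoneOn _).integrableOn_isCompact isCompact_Icc).mono_set hs

end Survival

section CVaR

variable {X Y : Type*} [MeasurableSpace X] [MeasurableSpace Y] {P : Measure X} {Q : Measure Y}
  [IsProbabilityMeasure P] [IsProbabilityMeasure Q] {α : ℝ} {Z : X → ℝ} {W : Y → ℝ} {lo hi t : ℝ}

lemma integral_le_add_inv_mul_integral_max (hα0 : 0 < α) (hα1 : α ≤ 1) (hZ : Integrable Z P)
    (η : ℝ) : ∫ x, Z x ∂P ≤ η + α⁻¹ * ∫ x, max (Z x - η) 0 ∂P := by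
  have hexcess : Integrable (fun x => max (Z x - η) 0) P := (hZ.sub (integrable_const η)).pos_part
  calc ∫ x, Z x ∂P = η + ∫ x, (Z x - η) ∂P := by rw [integral_sub hZ (by simp)]; simp
    _ ≤ η + ∫ x, max (Z x - η) 0 ∂P := by
        gcongr
        · exact hZ.sub (integrable_const η)
        · exact fun x => le_max_left _ _
    _ ≤ η + α⁻¹ * ∫ x, max (Z x - η) 0 ∂P := by
        gcongr
        exact le_mul_of_one_le_left (integral_nonneg fun x => le_max_right _ _)
          ((one_le_inv₀ hα0).2 hα1)

lemma bddBelow_range_add_inv_mul_integral_max (hα0 : 0 < α) (hα1 : α ≤ 1) (hZ : Integrable Z P) :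
    BddBelow (Set.range fun η : ℝ => η + α⁻¹ * ∫ x, max (Z x - η) 0 ∂P) :=
  ⟨∫ x, Z x ∂P, Set.forall_mem_range.2 (integral_le_add_inv_mul_integral_max hα0 hα1 hZ)⟩

lemma le_CVaR_of_ae_le (hα0 : 0 < α) (hα1 : α ≤ 1) (hZ : Integrable Z P) (ht : ∀ᵐ x ∂P, t ≤ Z x) :
    t ≤ CVaR P α Z := by
  have hmean : t ≤ ∫ x, Z x ∂P := by simpa using integral_mono_ae (integrable_const t) hZ ht
  exact le_ciInf fun η => hmean.trans (integral_le_add_inv_mul_integral_max hα0 hα1 hZ η)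

lemma CVaR_le_of_ae_le (hα0 : 0 < α) (hα1 : α ≤ 1) (hZ : Integrable Z P) (ht : ∀ᵐ x ∂P, Z x ≤ t) :
    CVaR P α Z ≤ t := by
  refine (ciInf_le (bddBelow_range_add_inv_mul_integral_max hα0 hα1 hZ) t).trans_eq ?_
  have hzero : (fun x => max (Z x - t) 0) =ᵐ[P] 0 := by
    filter_upwards [ht] with x hx
    exact max_eq_right (sub_nonpos.2 hx)
  simp [integral_congr_ae hzero]

lemma measureReal_setOf_lt_eq_one (hle : ∀ᵐ x ∂P, lo ≤ Z x) (ht : t < lo) :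
    P.real {x | t < Z x} = 1 := by
  rw [← probReal_univ (μ := P)]
  refine measureReal_congr (eventuallyEq_univ.2 ?_)
  filter_upwards [hle] with x hx using ht.trans_le hx

lemma abs_integral_max_sub_integral_max_le (hZ : AEMeasurable Z P) (hW : AEMeasurable W Q)
    (hZmem : ∀ᵐ x ∂P, Z x ∈ Set.Icc lo hi) (hWmem : ∀ᵐ y ∂Q, W y ∈ Set.Icc lo hi) (η : ℝ) :
    |∫ x, max (Z x - η) 0 ∂P - ∫ y, max (W y - η) 0 ∂Q|
      ≤ ∫ t in Set.Icc lo hi, |P.real {x | t < Z x} - Q.real {y | t < W y}| := by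
  let D : ℝ → ℝ := fun t => P.real {x | t < Z x} - Q.real {y | t < W y}
  have hD_zero (t : ℝ) (ht : t ∈ Set.Ioc η hi \ (Set.Ioc η hi ∩ Set.Icc lo hi)) : |D t| = 0 := by
    have hlo : t < lo := not_le.1 fun h => ht.2 ⟨ht.1, h, ht.1.2⟩
    simp [D, measureReal_setOf_lt_eq_one (hZmem.mono fun _ hx => hx.1) hlo,
      measureReal_setOf_lt_eq_one (hWmem.mono fun _ hx => hx.1) hlo]
  rw [integral_max_sub_eq_setIntegral_survival (.of_mem_Icc lo hi hZ hZmem)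
      (hZmem.mono fun x hx => hx.2),
    integral_max_sub_eq_setIntegral_survival (.of_mem_Icc lo hi hW hWmem)
      (hWmem.mono fun x hx => hx.2),
    ← integral_sub (integrableOn_survival Set.Ioc_subset_Icc_self)
      (integrableOn_survival Set.Ioc_subset_Icc_self)]
  calc |∫ t in Set.Ioc η hi, D t| ≤ ∫ t in Set.Ioc η hi, |D t| := abs_integral_le_integral_abs
    _ = ∫ t in Set.Ioc η hi ∩ Set.Icc lo hi, |D t| :=
        setIntegral_eq_of_subset_of_forall_sdiff_eq_zero measurableSet_Ioc
          Set.inter_subset_left hD_zero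
    _ ≤ ∫ t in Set.Icc lo hi, |D t| :=
        setIntegral_mono_set
          ((integrableOn_survival subset_rfl).sub (integrableOn_survival subset_rfl)).abs
          (ae_of_all _ fun t => abs_nonneg _) (ae_of_all _ Set.inter_subset_right)

/-- The integral is the 1-Wasserstein distance between the laws of `Z` and `W`. -/
lemma abs_CVaR_sub_CVaR_le (hα0 : 0 < α) (hα1 : α ≤ 1) (hZ : AEMeasurable Z P)
    (hW : AEMeasurable W Q) (hZmem : ∀ᵐ x ∂P, Z x ∈ Set.Icc lo hi)
    (hWmem : ∀ᵐ y ∂Q, W y ∈ Set.Icc lo hi) :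
    |CVaR P α Z - CVaR Q α W|
      ≤ α⁻¹ * ∫ t in Set.Icc lo hi, |P.real {x | t < Z x} - Q.real {y | t < W y}| := by
  set R := ∫ t in Set.Icc lo hi, |P.real {x | t < Z x} - Q.real {y | t < W y}|
  have hobjective (η : ℝ) := (abs_le.1 (abs_integral_max_sub_integral_max_le hZ hW hZmem hWmem η))
  have hbddZ := bddBelow_range_add_inv_mul_integral_max hα0 hα1 (.of_mem_Icc lo hi hZ hZmem)
  have hbddW := bddBelow_range_add_inv_mul_integral_max hα0 hα1 (.of_mem_Icc lo hi hW hWmem)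
  have hinv := inv_nonneg.2 hα0.le
  rw [abs_sub_le_iff]
  constructor <;> rw [sub_le_iff_le_add', ← sub_le_iff_le_add]
  · refine le_ciInf fun η => ?_
    have := mul_le_mul_of_nonneg_left (hobjective η).2 hinv
    have : CVaR P α Z ≤ η + α⁻¹ * ∫ x, max (Z x - η) 0 ∂P := ciInf_le hbddZ η
    linarith
  · refine le_ciInf fun η => ?_
    have := mul_le_mul_of_nonneg_left (hobjective η).1 hinv
    have : CVaR Q α W ≤ η + α⁻¹ * ∫ y, max (W y - η) 0 ∂Q := ciInf_le hbddW η
    linarith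

end CVaR

section Empirical

variable {N : ℕ}

lemma integral_uniformOn_univ (f : Fin N → ℝ) :
    ∫ j, f j ∂(uniformOn Set.univ) = (N : ℝ)⁻¹ * ∑ j, f j := by
  rw [integral_fintype .of_finite, Finset.mul_sum]
  simp [measureReal_def, uniformOn_univ]

lemma empCVaR_eq_CVaR (α : ℝ) (z : Fin N → ℝ) :
    empCVaR α z = CVaR (uniformOn Set.univ) α z := by
  simp only [empCVaR, CVaR, integral_uniformOn_univ, mul_inv_rev, mul_assoc]

lemma measureReal_uniformOn_univ (s : Set (Fin N)) :
    (uniformOn Set.univ).real s = (N : ℝ)⁻¹ * ∑ j, s.indicator 1 j := by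
  rw [← integral_uniformOn_univ, integral_indicator_one (.of_discrete)]

variable {X : Type*} [MeasurableSpace X] {P : Measure X} [IsProbabilityMeasure P]

lemma integral_abs_le_sqrt_integral_sq {f : X → ℝ} (hf : MemLp f 2 P) :
    ∫ x, |f x| ∂P ≤ √(∫ x, f x ^ 2 ∂P) := by
  refine Real.le_sqrt_of_sq_le ?_
  have := variance_nonneg |f| P
  rw [variance_eq_sub hf.abs] at this
  simpa using this

lemma integral_abs_sampleMean_sub_le [NeZero N] {Y : X → ℝ} (hY : MemLp Y 2 P) :
    ∫ x : Fin N → X, |(N : ℝ)⁻¹ * ∑ j, Y (x j) - ∫ y, Y y ∂P| ∂(Measure.pi fun _ => P)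
      ≤ √(Var[Y; P] / N) := by
  have hN : (N : ℝ) ≠ 0 := NeZero.ne _
  have hYj (j : Fin N) : MemLp (fun x : Fin N → X => Y (x j)) 2 (Measure.pi fun _ => P) :=
    hY.comp_measurePreserving (measurePreserving_eval (fun _ : Fin N => P) j)
  have hsum : MemLp (fun x : Fin N → X => (N : ℝ)⁻¹ * ∑ j, Y (x j)) 2 (Measure.pi fun _ => P) :=
    (memLp_finsetSum _ fun j _ => hYj j).const_mul _
  have hmean : ∫ x : Fin N → X, (N : ℝ)⁻¹ * ∑ j, Y (x j) ∂(Measure.pi fun _ => P)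
      = ∫ y, Y y ∂P := by
    have heval (j : Fin N) : ∫ x : Fin N → X, Y (x j) ∂(Measure.pi fun _ => P) = ∫ y, Y y ∂P :=
      integral_comp_eval (μ := fun _ : Fin N => P) hY.aestronglyMeasurable
    rw [integral_const_mul, integral_finsetSum _ fun j _ => (hYj j).integrable one_le_two]
    simp [heval, hN]
  have hvar : Var[fun x : Fin N → X => (N : ℝ)⁻¹ * ∑ j, Y (x j); Measure.pi fun _ => P]
      = Var[Y; P] / N := by
    have := variance_sum_pi (μ := fun _ : Fin N => P) (X := fun _ => Y) fun _ => hY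
    rw [variance_const_mul, ← Finset.sum_fn, this]
    simp
    field_simp
  refine (integral_abs_le_sqrt_integral_sq (hsum.sub (memLp_const _))).trans_eq ?_
  rw [← hvar, variance_eq_integral hsum.aestronglyMeasurable.aemeasurable, hmean]
  rfl

variable {Z : X → ℝ} {α lo hi : ℝ}

lemma integral_abs_empSurvival_sub_le [NeZero N] (hZ : Measurable Z) (t : ℝ) :
    ∫ x : Fin N → X, |(uniformOn Set.univ).real {j | t < Z (x j)} - P.real {y | t < Z y}|
      ∂(Measure.pi fun _ => P) ≤ 1 / (2 * √N) := by
  let Y : X → ℝ := {y | t < Z y}.indicator 1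
  have hmeas : MeasurableSet {y | t < Z y} := measurableSet_lt measurable_const hZ
  have hY : Measurable Y := measurable_one.indicator hmeas
  have hY01 (y : X) : Y y ∈ Set.Icc 0 1 := by
    rw [Set.mem_Icc]; simp only [Y, Set.indicator]; split_ifs <;> simp
  have hvar : Var[Y; P] / N ≤ (1 / (2 * √N)) ^ 2 := by
    have := variance_le_sq_of_bounded (ae_of_all P hY01) hY.aemeasurable
    rw [div_pow, mul_pow, Real.sq_sqrt N.cast_nonneg, ← div_div]
    gcongr
    linarith
  have hempirical (x : Fin N → X) :
      (uniformOn Set.univ).real {j | t < Z (x j)} = (N : ℝ)⁻¹ * ∑ j, Y (x j) := by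
    rw [measureReal_uniformOn_univ]; rfl
  simp only [hempirical, ← integral_indicator_one hmeas]
  exact (integral_abs_sampleMean_sub_le (memLp_of_bounded (ae_of_all P hY01)
    hY.aestronglyMeasurable 2)).trans (Real.sqrt_le_iff.2 ⟨by positivity, hvar⟩)

lemma measurable_empSurvival_sub (hZ : Measurable Z) :
    Measurable fun p : (Fin N → X) × ℝ =>
      (uniformOn Set.univ).real {j | p.2 < Z (p.1 j)} - P.real {y | p.2 < Z y} := by
  have hind (j : Fin N) : Measurable fun p : (Fin N → X) × ℝ =>
      {j | p.2 < Z (p.1 j)}.indicator (1 : Fin N → ℝ) j :=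
    measurable_one.indicator (measurableSet_lt measurable_snd (by fun_prop))
  simp only [measureReal_uniformOn_univ]
  exact ((Finset.measurable_fun_sum _ fun j _ => hind j).const_mul _).sub
    (antitone_survival.measurable.comp measurable_snd)

lemma integrable_abs_empSurvival_sub {μ : Measure ((Fin N → X) × ℝ)} [IsFiniteMeasure μ]
    (hZ : Measurable Z) :
    Integrable (fun p : (Fin N → X) × ℝ =>
      |(uniformOn Set.univ).real {j | p.2 < Z (p.1 j)} - P.real {y | p.2 < Z y}|) μ := by
  refine (Integrable.of_mem_Icc (-1) 1 (measurable_empSurvival_sub hZ).aemeasurable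
    (ae_of_all _ fun p => abs_le.1 ?_)).abs
  exact abs_sub_le_of_nonneg_of_le measureReal_nonneg measureReal_le_one measureReal_nonneg
    measureReal_le_one

lemma integral_abs_empCVaR_sub_CVaR_le [NeZero N] (hα0 : 0 < α) (hα1 : α ≤ 1)
    (hZ : Measurable Z) (hmem : ∀ᵐ y ∂P, Z y ∈ Set.Icc lo hi) :
    ∫ x : Fin N → X, |empCVaR α (fun j => Z (x j)) - CVaR P α Z| ∂(Measure.pi fun _ => P)
      ≤ (hi - lo) / (2 * α * √N) := by
  have hlohi : lo ≤ hi := by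
    obtain ⟨y, hy⟩ := hmem.exists
    exact hy.1.trans hy.2
  let Q : Measure (Fin N → X) := Measure.pi fun _ => P
  let D : (Fin N → X) → ℝ → ℝ := fun x t =>
    (uniformOn Set.univ).real {j | t < Z (x j)} - P.real {y | t < Z y}
  have hD_int : Integrable (Function.uncurry fun x t => |D x t|)
      (Q.prod (volume.restrict (Set.Icc lo hi))) := integrable_abs_empSurvival_sub hZ
  have hstab : ∀ᵐ x ∂Q, |empCVaR α (fun j => Z (x j)) - CVaR P α Z|
      ≤ α⁻¹ * ∫ t in Set.Icc lo hi, |D x t| := by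
    have hsample : ∀ᵐ x ∂Q, ∀ j, Z (x j) ∈ Set.Icc lo hi := ae_all_iff.2 fun j =>
      (Measure.quasiMeasurePreserving_eval (fun _ : Fin N => P) j).ae hmem
    filter_upwards [hsample] with x hx
    rw [empCVaR_eq_CVaR]
    exact abs_CVaR_sub_CVaR_le hα0 hα1 (by fun_prop) hZ.aemeasurable (ae_of_all _ hx) hmem
  calc ∫ x, |empCVaR α (fun j => Z (x j)) - CVaR P α Z| ∂Q
      ≤ ∫ x, α⁻¹ * (∫ t in Set.Icc lo hi, |D x t|) ∂Q :=
        integral_mono_of_nonneg (ae_of_all _ fun x => abs_nonneg _)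
          (hD_int.integral_prod_left.const_mul _) hstab
    _ = α⁻¹ * ∫ t in Set.Icc lo hi, ∫ x, |D x t| ∂Q := by
        rw [integral_const_mul, integral_integral_swap hD_int]
    _ ≤ α⁻¹ * ∫ t in Set.Icc lo hi, 1 / (2 * √N) := by
        gcongr
        · exact hD_int.integral_prod_right
        · exact integrableOn_const (by simp)
        · exact measurableSet_Icc.nullMeasurableSet
        · exact integral_abs_empSurvival_sub_le hZ _
    _ = (hi - lo) / (2 * α * √N) := by
        rw [setIntegral_const, Real.volume_real_Icc_of_le hlohi, smul_eq_mul]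
        field_simp

end Empirical

section SampleError

variable {X : Type*} [MeasurableSpace X] {P : Measure X} [IsProbabilityMeasure P] {N : ℕ}
  {α lo hi : ℝ} {Z : X → ℝ}

lemma le_empCVaR [NeZero N] (hα0 : 0 < α) (hα1 : α ≤ 1) {z : Fin N → ℝ} {t : ℝ}
    (ht : ∀ j, t ≤ z j) : t ≤ empCVaR α z := by
  rw [empCVaR_eq_CVaR]
  exact le_CVaR_of_ae_le hα0 hα1 .of_finite (ae_of_all _ ht)

lemma empCVaR_le [NeZero N] (hα0 : 0 < α) (hα1 : α ≤ 1) {z : Fin N → ℝ} {t : ℝ}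
    (ht : ∀ j, z j ≤ t) : empCVaR α z ≤ t := by
  rw [empCVaR_eq_CVaR]
  exact CVaR_le_of_ae_le hα0 hα1 .of_finite (ae_of_all _ ht)

lemma measurable_empCVaR (hα0 : 0 < α) (hα1 : α ≤ 1) :
    Measurable fun z : Fin N → ℝ => empCVaR α z := by
  rcases N.eq_zero_or_pos with rfl | hN
  · exact Subsingleton.measurable
  have : NeZero N := ⟨hN.ne'⟩
  refine UpperSemicontinuous.measurable
    (upperSemicontinuous_ciInf (fun z => ?_) fun η => Continuous.upperSemicontinuous ?_)
  · simpa [integral_uniformOn_univ, mul_assoc] using bddBelow_range_add_inv_mul_integral_max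
      (P := uniformOn (Set.univ : Set (Fin N))) hα0 hα1 (.of_finite (f := z))
  · fun_prop

lemma measure_eq_zero_of_ae_pi_exists_notMem {s : Set X}
    (h : ∀ᵐ x ∂Measure.pi (fun _ : Fin N => P), ∃ j, x j ∉ s) : P s = 0 := by
  have hpi : Measure.pi (fun _ : Fin N => P) (Set.univ.pi fun _ => s) = 0 :=
    measure_mono_null (fun x hx => not_exists_not.2 fun j => hx j trivial) h
  rw [Measure.pi_pi, Finset.prod_const] at hpi
  exact eq_zero_of_pow_eq_zero hpi

lemma ae_mem_Icc_of_ae_empCVaR_mem_Icc [NeZero N] (hα0 : 0 < α) (hα1 : α ≤ 1)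
    (h : ∀ᵐ x ∂Measure.pi (fun _ : Fin N => P), empCVaR α (fun j => Z (x j)) ∈ Set.Icc lo hi) :
    ∀ᵐ y ∂P, Z y ∈ Set.Icc lo hi := by
  -- The estimator lies between the smallest and the largest sample, and all `N` samples fall
  -- simultaneously into any given set of positive measure with positive probability.
  refine ((ae_const_le_iff_forall_lt_measure_zero _ _).2 fun t ht => ?_).and
    ((ae_le_const_iff_forall_gt_measure_zero _ _).2 fun t ht => ?_)
  · refine measure_eq_zero_of_ae_pi_exists_notMem (N := N) (h.mono fun x hx => ?_)
    by_contra! hall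
    exact ((hx.1.trans (empCVaR_le hα0 hα1 hall)).trans_lt ht).false
  · refine measure_eq_zero_of_ae_pi_exists_notMem (N := N) (h.mono fun x hx => ?_)
    by_contra! hall
    exact ((le_empCVaR hα0 hα1 hall).trans hx.2).not_gt ht

end SampleError

section EstimationError

variable {n m N : ℕ} {P : Measure (E m)} {α : ℝ} {C : E n → E m → E n}

lemma measurable_estError (hα0 : 0 < α) (hα1 : α ≤ 1) (hC : Measurable (Function.uncurry C))
    (hF : Measurable (cvarMap P α C)) :
    Measurable fun p : E n × (Fin N → E m) => estError P α C p.2 p.1 := by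
  refine Measurable.sub ?_ (hF.comp measurable_fst)
  refine (WithLp.measurable_toLp 2 (Fin n → ℝ)).comp (measurable_pi_lambda _ fun i => ?_)
  refine (measurable_empCVaR hα0 hα1).comp (measurable_pi_lambda _ fun j => ?_)
  have hCj : Measurable fun p : E n × (Fin N → E m) => C p.1 (p.2 j) :=
    hC.comp (measurable_fst.prodMk ((measurable_pi_apply j).comp measurable_snd))
  exact (EuclideanSpace.proj (𝕜 := ℝ) i).measurable.comp hCj

lemma measurable_inner_estError (hα0 : 0 < α) (hα1 : α ≤ 1)
    (hC : Measurable (Function.uncurry C)) (hF : Measurable (cvarMap P α C)) (x : E n) :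
    Measurable fun p : E n × (Fin N → E m) => inner ℝ (p.1 - x) (estError P α C p.2 p.1) :=
  (measurable_fst.sub_const x).inner (measurable_estError hα0 hα1 hC hF)

lemma measurable_estError_left (hα0 : 0 < α) (hα1 : α ≤ 1) {h : E n} (hC : Measurable (C h)) :
    Measurable fun z : Fin N → E m => estError P α C z h := by
  refine Measurable.sub_const ?_ _
  refine (WithLp.measurable_toLp 2 (Fin n → ℝ)).comp (measurable_pi_lambda _ fun i => ?_)
  exact (measurable_empCVaR hα0 hα1).comp
    (by fun_prop : Measurable fun z : Fin N → E m => fun j => C h (z j) i)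

lemma integral_abs_estError_apply_le [IsProbabilityMeasure P] [NeZero N] (hα0 : 0 < α)
    (hα1 : α ≤ 1) {h : E n} (hC : Measurable (C h)) {B : ℝ}
    (hB : ∀ᵐ z ∂Measure.pi (fun _ : Fin N => P), ‖estError P α C z h‖ ≤ B) (i : Fin n) :
    ∫ z, |estError P α C z h i| ∂(Measure.pi fun _ : Fin N => P) ≤ B / (α * √N) := by
  have hemp : ∀ᵐ z ∂Measure.pi (fun _ : Fin N => P), empCVaR α (fun j => C h (z j) i)
      ∈ Set.Icc (cvarMap P α C h i - B) (cvarMap P α C h i + B) := by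
    filter_upwards [hB] with z hz
    exact Set.mem_Icc_iff_abs_le.1
      ((abs_sub_comm _ _).trans_le ((PiLp.norm_apply_le (estError P α C z h) i).trans hz))
  refine (integral_abs_empCVaR_sub_CVaR_le hα0 hα1 (by fun_prop)
    (ae_mem_Icc_of_ae_empCVaR_mem_Icc (Z := fun y => C h y i) hα0 hα1 hemp)).trans_eq ?_
  field_simp
  ring

lemma norm_le_sum_abs (v : E n) : ‖v‖ ≤ ∑ i, |v i| := by
  rw [EuclideanSpace.norm_eq]
  exact Real.sqrt_le_iff.2 ⟨by positivity,
    Finset.sum_sq_le_sq_sum_of_nonneg fun i _ => abs_nonneg _⟩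

lemma integral_norm_estError_le [IsProbabilityMeasure P] [NeZero N] (hα0 : 0 < α) (hα1 : α ≤ 1)
    {h : E n} (hC : Measurable (C h)) {B : ℝ}
    (hB : ∀ᵐ z ∂Measure.pi (fun _ : Fin N => P), ‖estError P α C z h‖ ≤ B) :
    ∫ z, ‖estError P α C z h‖ ∂(Measure.pi fun _ : Fin N => P) ≤ n * (B / (α * √N)) := by
  have hint (i : Fin n) : Integrable (fun z => |estError P α C z h i|)
      (Measure.pi fun _ : Fin N => P) := by
    have hmeas : Measurable fun z : Fin N → E m => estError P α C z h i :=
      (EuclideanSpace.proj (𝕜 := ℝ) i).measurable.comp (measurable_estError_left hα0 hα1 hC)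
    refine Integrable.of_bound hmeas.abs.aestronglyMeasurable B (hB.mono fun z hz => ?_)
    simpa using (PiLp.norm_apply_le (estError P α C z h) i).trans hz
  calc ∫ z, ‖estError P α C z h‖ ∂(Measure.pi fun _ : Fin N => P)
      ≤ ∫ z, ∑ i, |estError P α C z h i| ∂(Measure.pi fun _ : Fin N => P) :=
        integral_mono_of_nonneg (ae_of_all _ fun z => norm_nonneg _)
          (integrable_finsetSum _ fun i _ => hint i) (ae_of_all _ fun z => norm_le_sum_abs _)
    _ = ∑ i, ∫ z, |estError P α C z h i| ∂(Measure.pi fun _ : Fin N => P) :=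
        integral_finsetSum _ fun i _ => hint i
    _ ≤ ∑ _i : Fin n, B / (α * √N) :=
        Finset.sum_le_sum fun i _ => integral_abs_estError_apply_le hα0 hα1 hC hB i
    _ = n * (B / (α * √N)) := by simp

end EstimationError

section L2Martingale

variable {Ω : Type*} {m mΩ : MeasurableSpace Ω} {μ : Measure Ω} [IsFiniteMeasure μ]
  {ℱ : Filtration ℕ mΩ} {D : ℕ → Ω → ℝ}

lemma integral_mul_eq_zero_of_condExp_eq_zero (hm : m ≤ mΩ) {f g : Ω → ℝ}
    (hf : StronglyMeasurable[m] f) (hfg : Integrable (f * g) μ) (hg : Integrable g μ)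
    (hcond : μ[g | m] =ᵐ[μ] 0) : ∫ ω, f ω * g ω ∂μ = 0 := by
  have hpull : μ[f * g | m] =ᵐ[μ] 0 := by
    filter_upwards [condExp_mul_of_stronglyMeasurable_left hf hfg hg, hcond] with ω hω hzero
    simp [hω, hzero]
  calc ∫ ω, f ω * g ω ∂μ = ∫ ω, (μ[f * g | m]) ω ∂μ := (integral_condExp hm).symm
    _ = 0 := integral_eq_zero_of_ae hpull

lemma stronglyAdapted_sum_range (hD : ∀ k, StronglyMeasurable[ℱ (k + 1)] (D k)) :
    StronglyAdapted ℱ fun k => ∑ i ∈ Finset.range k, D i := fun _ =>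
  Finset.stronglyMeasurable_sum _ fun i hi => (hD i).mono (ℱ.mono (Finset.mem_range.1 hi))

lemma martingale_sum_range (hD : ∀ k, StronglyMeasurable[ℱ (k + 1)] (D k))
    (hint : ∀ k, Integrable (D k) μ) (hcond : ∀ k, μ[D k | ℱ k] =ᵐ[μ] 0) :
    Martingale (fun k => ∑ i ∈ Finset.range k, D i) ℱ μ :=
  martingale_of_condExp_sub_eq_zero_nat (stronglyAdapted_sum_range hD)
    (fun k => integrable_finsetSum' _ fun i _ => hint i) fun k => by
      simpa only [Finset.sum_range_succ, add_sub_cancel_left] using hcond k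

lemma integral_sq_sum_range (hD : ∀ k, StronglyMeasurable[ℱ (k + 1)] (D k))
    (hL2 : ∀ k, MemLp (D k) 2 μ) (hcond : ∀ k, μ[D k | ℱ k] =ᵐ[μ] 0) (k : ℕ) :
    ∫ ω, (∑ i ∈ Finset.range k, D i) ω ^ 2 ∂μ = ∑ i ∈ Finset.range k, ∫ ω, D i ω ^ 2 ∂μ := by
  induction k with
  | zero => simp
  | succ k ih =>
    have hSL2 : MemLp (∑ i ∈ Finset.range k, D i) 2 μ := memLp_finsetSum' _ fun i _ => hL2 i
    have hSD : Integrable ((∑ i ∈ Finset.range k, D i) * D k) μ := hSL2.integrable_mul (hL2 k)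
    have horth : ∫ ω, (∑ i ∈ Finset.range k, D i) ω * D k ω ∂μ = 0 :=
      integral_mul_eq_zero_of_condExp_eq_zero (ℱ.le k) (stronglyAdapted_sum_range hD k) hSD
        ((hL2 k).integrable one_le_two) (hcond k)
    rw [Finset.sum_range_succ (fun i => ∫ ω, D i ω ^ 2 ∂μ), ← ih, Finset.sum_range_succ]
    set S := ∑ i ∈ Finset.range k, D i
    calc ∫ ω, (S + D k) ω ^ 2 ∂μ = ∫ ω, (S ω ^ 2 + D k ω ^ 2 + 2 * (S ω * D k ω)) ∂μ := by
          congr with ω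
          rw [Pi.add_apply]
          ring
      _ = ∫ ω, (S ω ^ 2 + D k ω ^ 2) ∂μ + ∫ ω, 2 * (S ω * D k ω) ∂μ :=
          integral_add (hSL2.integrable_sq.add (hL2 k).integrable_sq) (hSD.const_mul 2)
      _ = ∫ ω, S ω ^ 2 ∂μ + ∫ ω, D k ω ^ 2 ∂μ := by
          rw [integral_const_mul, horth, mul_zero, add_zero,
            integral_add hSL2.integrable_sq (hL2 k).integrable_sq]

end L2Martingale

section ConvergentNoise

variable {Ω : Type*} {m mΩ : MeasurableSpace Ω} {μ : Measure Ω} [IsProbabilityMeasure μ]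
  {ℱ : Filtration ℕ mΩ} {D X : ℕ → Ω → ℝ}

lemma ae_exists_tendsto_sum_of_summable_integral_sq
    (hD : ∀ k, StronglyMeasurable[ℱ (k + 1)] (D k)) (hL2 : ∀ k, MemLp (D k) 2 μ)
    (hcond : ∀ k, μ[D k | ℱ k] =ᵐ[μ] 0) (hsum : Summable fun k => ∫ ω, D k ω ^ 2 ∂μ) :
    ∀ᵐ ω ∂μ, ∃ L, Tendsto (fun k => ∑ i ∈ Finset.range k, D i ω) atTop (𝓝 L) := by
  have hmart := martingale_sum_range hD (fun k => (hL2 k).integrable one_le_two) hcond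
  simp only [← Finset.sum_apply]
  refine hmart.submartingale.exists_ae_tendsto_of_bdd
    (R := Real.toNNReal √(∑' k, ∫ ω, D k ω ^ 2 ∂μ)) fun k => ?_
  rw [eLpNorm_one_eq_lintegral_enorm,
    ← ofReal_integral_norm_eq_lintegral_enorm (hmart.integrable k)]
  refine ENNReal.ofReal_le_ofReal ?_
  calc ∫ ω, |(∑ i ∈ Finset.range k, D i) ω| ∂μ
      ≤ √(∫ ω, (∑ i ∈ Finset.range k, D i) ω ^ 2 ∂μ) :=
        integral_abs_le_sqrt_integral_sq (memLp_finsetSum' _ fun i _ => hL2 i)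
    _ = √(∑ i ∈ Finset.range k, ∫ ω, D i ω ^ 2 ∂μ) := by rw [integral_sq_sum_range hD hL2 hcond]
    _ ≤ √(∑' k, ∫ ω, D k ω ^ 2 ∂μ) :=
        Real.sqrt_le_sqrt (hsum.sum_le_tsum _ fun i _ => integral_nonneg fun ω => sq_nonneg _)

lemma integral_sq_sub_condExp_le {f : Ω → ℝ} {R : ℝ} (hR : ∀ᵐ ω ∂μ, |f ω| ≤ R) :
    ∫ ω, (f ω - (μ[f | m]) ω) ^ 2 ∂μ ≤ (2 * R) ^ 2 := by
  have hbound : ∀ᵐ ω ∂μ, (f ω - (μ[f | m]) ω) ^ 2 ≤ (2 * R) ^ 2 := by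
    filter_upwards [hR, ae_bdd_abs_condExp_of_ae_bdd_abs (m := m) hR] with ω hf hcond
    have := (abs_sub (f ω) ((μ[f | m]) ω)).trans (add_le_add hf hcond)
    exact sq_le_sq' (by linarith [(abs_le.1 this).1]) (by linarith [(abs_le.1 this).2])
  simpa using integral_mono_of_nonneg (ae_of_all _ fun ω => sq_nonneg _)
    (integrable_const ((2 * R) ^ 2)) hbound

lemma ae_exists_tendsto_sum_mul_sub_condExp
    (hX : ∀ k, StronglyMeasurable[ℱ (k + 1)] (X k)) {R : ℝ}
    (hR : ∀ k, ∀ᵐ ω ∂μ, |X k ω| ≤ R) {γ : ℕ → ℝ} (hγ : Summable fun k => γ k ^ 2) :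
    ∀ᵐ ω ∂μ, ∃ L, Tendsto
      (fun k => ∑ i ∈ Finset.range k, γ i * (X i ω - (μ[X i | ℱ i]) ω)) atTop (𝓝 L) := by
  have hXL2 (k : ℕ) : MemLp (X k) 2 μ :=
    MemLp.of_bound ((hX k).mono (ℱ.le _)).aestronglyMeasurable R (hR k)
  have hint (k : ℕ) : Integrable (X k) μ := (hXL2 k).integrable one_le_two
  refine ae_exists_tendsto_sum_of_summable_integral_sq (ℱ := ℱ)
    (D := fun k => γ k • (X k - μ[X k | ℱ k])) (fun k => ?_) (fun k => ?_) (fun k => ?_) ?_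
  · exact ((hX k).sub (stronglyMeasurable_condExp.mono (ℱ.mono k.le_succ))).const_smul _
  · exact ((hXL2 k).sub ((hXL2 k).condExp one_le_two)).const_smul _
  · have hidem : μ[μ[X k | ℱ k] | ℱ k] = μ[X k | ℱ k] :=
      condExp_of_stronglyMeasurable (ℱ.le k) stronglyMeasurable_condExp integrable_condExp
    filter_upwards [condExp_smul (γ k) (X k - μ[X k | ℱ k]) (ℱ k),
      condExp_sub (hint k) (integrable_condExp (m := ℱ k) (f := X k)) (ℱ k)] with ω hsmul hsub
    simp [hsmul, hsub, hidem]
  · simp only [Pi.smul_apply, Pi.sub_apply, smul_eq_mul, mul_pow, integral_const_mul]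
    refine (hγ.mul_right ((2 * R) ^ 2)).of_nonneg_of_le (fun k => by positivity) fun k => ?_
    gcongr
    exact integral_sq_sub_condExp_le (hR k)

end ConvergentNoise

section Freezing

variable {Ω β ζ : Type*} {m mΩ : MeasurableSpace Ω} [MeasurableSpace β] [MeasurableSpace ζ]
  {μ : Measure Ω} [IsProbabilityMeasure μ] {Y : Ω → β} {Z : Ω → ζ}

lemma map_restrict_prodMk_of_indep (hm : m ≤ mΩ) (hY : Measurable[m] Y) (hZ : Measurable Z)
    (hind : Indep m (MeasurableSpace.comap Z inferInstance) μ) {s : Set Ω}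
    (hs : MeasurableSet[m] s) :
    (μ.restrict s).map (fun ω => (Y ω, Z ω)) = ((μ.restrict s).map Y).prod (μ.map Z) := by
  have hYm : Measurable Y := hY.mono hm le_rfl
  refine (Measure.prod_eq fun A B hA hB => ?_).symm
  rw [Measure.map_apply (hYm.prodMk hZ) (hA.prod hB), Measure.map_apply hYm hA,
    Measure.map_apply hZ hB, Measure.restrict_apply (hYm.prodMk hZ (hA.prod hB)),
    Measure.restrict_apply (hYm hA), Set.mk_preimage_prod, Set.inter_right_comm]
  exact (Indep_iff _ _ _).1 hind _ _ ((hY hA).inter hs) ⟨B, hB, rfl⟩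

lemma map_prodMk_of_indep (hm : m ≤ mΩ) (hY : Measurable[m] Y) (hZ : Measurable Z)
    (hind : Indep m (MeasurableSpace.comap Z inferInstance) μ) :
    μ.map (fun ω => (Y ω, Z ω)) = (μ.map Y).prod (μ.map Z) := by
  simpa using map_restrict_prodMk_of_indep hm hY hZ hind MeasurableSet.univ

lemma ae_ae_map_of_indep (hm : m ≤ mΩ) (hY : Measurable[m] Y) (hZ : Measurable Z)
    (hind : Indep m (MeasurableSpace.comap Z inferInstance) μ) {p : β × ζ → Prop}
    (hp : MeasurableSet {x | p x}) (h : ∀ᵐ ω ∂μ, p (Y ω, Z ω)) :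
    ∀ᵐ ω ∂μ, ∀ᵐ z ∂μ.map Z, p (Y ω, z) := by
  have hYm : Measurable Y := hY.mono hm le_rfl
  refine ae_of_ae_map hYm.aemeasurable (p := fun y => ∀ᵐ z ∂μ.map Z, p (y, z))
    (Measure.ae_ae_of_ae_prod ?_)
  rw [← map_prodMk_of_indep hm hY hZ hind]
  exact (ae_map_iff (hYm.prodMk hZ).aemeasurable hp).2 h

lemma condExp_prodMk_of_indep (hm : m ≤ mΩ) (hY : Measurable[m] Y) (hZ : Measurable Z)
    (hind : Indep m (MeasurableSpace.comap Z inferInstance) μ) {φ : β × ζ → ℝ}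
    (hφ : Measurable φ) (hint : Integrable (fun ω => φ (Y ω, Z ω)) μ) :
    μ[fun ω => φ (Y ω, Z ω) | m] =ᵐ[μ] fun ω => ∫ z, φ (Y ω, z) ∂μ.map Z := by
  have hYm : Measurable Y := hY.mono hm le_rfl
  have : IsProbabilityMeasure (μ.map Z) := Measure.isProbabilityMeasure_map hZ.aemeasurable
  have hmean : StronglyMeasurable fun y => ∫ z, φ (y, z) ∂μ.map Z :=
    hφ.stronglyMeasurable.integral_prod_right'
  have hint_restrict {s : Set Ω} (hs : MeasurableSet[m] s) :
      Integrable φ (((μ.restrict s).map Y).prod (μ.map Z)) := by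
    rw [← map_restrict_prodMk_of_indep hm hY hZ hind hs,
      integrable_map_measure hφ.aestronglyMeasurable (hYm.prodMk hZ).aemeasurable]
    exact hint.integrableOn
  refine (ae_eq_condExp_of_forall_setIntegral_eq hm hint (fun s hs _ => ?_) (fun s hs _ => ?_)
    (hmean.measurable.comp hY).aestronglyMeasurable).symm
  · exact (integrable_map_measure hmean.aestronglyMeasurable hYm.aemeasurable).1
      (hint_restrict hs).integral_prod_left
  · calc ∫ ω in s, ∫ z, φ (Y ω, z) ∂μ.map Z ∂μ
        = ∫ y, ∫ z, φ (y, z) ∂μ.map Z ∂((μ.restrict s).map Y) :=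
          (integral_map hYm.aemeasurable hmean.aestronglyMeasurable).symm
      _ = ∫ p, φ p ∂(((μ.restrict s).map Y).prod (μ.map Z)) :=
          (integral_prod _ (hint_restrict hs)).symm
      _ = ∫ ω in s, φ (Y ω, Z ω) ∂μ := by
          rw [← map_restrict_prodMk_of_indep hm hY hZ hind hs,
            integral_map (hYm.prodMk hZ).aemeasurable hφ.aestronglyMeasurable]

end Freezing

section Bias

lemma abs_integral_inner_estError_le {n m N : ℕ} [NeZero N] {P : Measure (E m)}
    [IsProbabilityMeasure P] {α : ℝ} {C : E n → E m → E n} (hα0 : 0 < α) (hα1 : α ≤ 1)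
    {h : E n} (hC : Measurable (C h)) {B : ℝ}
    (hB : ∀ᵐ z ∂Measure.pi (fun _ : Fin N => P), ‖estError P α C z h‖ ≤ B) (v : E n) :
    |∫ z, inner ℝ v (estError P α C z h) ∂(Measure.pi fun _ : Fin N => P)|
      ≤ ‖v‖ * (n * (B / (α * √N))) := by
  have hint : Integrable (fun z => estError P α C z h) (Measure.pi fun _ : Fin N => P) :=
    Integrable.of_bound (measurable_estError_left hα0 hα1 hC).aestronglyMeasurable B hB
  calc |∫ z, inner ℝ v (estError P α C z h) ∂(Measure.pi fun _ : Fin N => P)|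
      = |inner ℝ v (∫ z, estError P α C z h ∂(Measure.pi fun _ : Fin N => P))| := by
        rw [integral_inner hint]
    _ ≤ ‖v‖ * ‖∫ z, estError P α C z h ∂(Measure.pi fun _ : Fin N => P)‖ :=
        abs_real_inner_le_norm _ _
    _ ≤ ‖v‖ * (n * (B / (α * √N))) := by
        gcongr
        exact (norm_integral_le_integral_norm _).trans
          (integral_norm_estError_le hα0 hα1 hC hB)

lemma ae_abs_condExp_inner_estError_le {n d N : ℕ} [NeZero N] {P : Measure (E d)}
    [IsProbabilityMeasure P] {α : ℝ} {C : E n → E d → E n} (hα0 : 0 < α) (hα1 : α ≤ 1)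
    (hC : Measurable (Function.uncurry C)) (hF : Measurable (cvarMap P α C))
    {Ω : Type*} {m mΩ : MeasurableSpace Ω} {μ : Measure Ω} [IsProbabilityMeasure μ] (hm : m ≤ mΩ)
    {h : Ω → E n} {Z : Ω → Fin N → E d} (hh : Measurable[m] h) (hZ : Measurable Z)
    (hind : Indep m (MeasurableSpace.comap Z inferInstance) μ)
    (hlaw : μ.map Z = Measure.pi fun _ => P) {x : E n} {D B : ℝ}
    (hD : ∀ᵐ ω ∂μ, ‖h ω - x‖ ≤ D) (hB : ∀ᵐ ω ∂μ, ‖estError P α C (Z ω) (h ω)‖ ≤ B) :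
    ∀ᵐ ω ∂μ, |(μ[fun ω => inner ℝ (h ω - x) (estError P α C (Z ω) (h ω)) | m]) ω|
      ≤ D * (n * (B / (α * √N))) := by
  have hφ := measurable_inner_estError (N := N) hα0 hα1 hC hF x
  have hint : Integrable (fun ω => inner ℝ (h ω - x) (estError P α C (Z ω) (h ω))) μ := by
    refine Integrable.of_bound
      (hφ.comp ((hh.mono hm le_rfl).prodMk hZ)).aestronglyMeasurable (D * B) ?_
    filter_upwards [hD, hB] with ω hDω hBω
    exact (norm_inner_le_norm _ _).trans
      (mul_le_mul hDω hBω (norm_nonneg _) ((norm_nonneg _).trans hDω))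
  have hfrozen := ae_ae_map_of_indep hm hh hZ hind
    (p := fun p => ‖estError P α C p.2 p.1‖ ≤ B)
    (measurableSet_le (measurable_estError hα0 hα1 hC hF).norm measurable_const) hB
  filter_upwards [condExp_prodMk_of_indep hm hh hZ hind hφ hint, hfrozen, hD] with ω hcond hBω hDω
  rw [hlaw] at hcond hBω
  rw [hcond]
  refine (abs_integral_inner_estError_le hα0 hα1 hC.of_uncurry_left hBω _).trans ?_
  have hB0 : 0 ≤ B := hBω.exists.elim fun _ hz => (norm_nonneg _).trans hz
  gcongr

end Bias

lemma exists_forall_ge_mul_div_sqrt_le (K B α : ℝ) {δ : ℝ} (hδ : 0 < δ) :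
    ∃ N₀ : ℕ, ∀ N ≥ N₀, 0 < N ∧ K * (B / (α * √N)) ≤ δ := by
  have hlim : Tendsto (fun N : ℕ => K * (B / α / √N)) atTop (𝓝 (K * 0)) :=
    ((Real.tendsto_sqrt_atTop.comp tendsto_natCast_atTop_atTop).const_div_atTop _).const_mul K
  simp only [mul_zero, div_div] at hlim
  exact eventually_atTop.1 ((eventually_gt_atTop 0).and (hlim.eventually_le_const hδ))

section Algorithm

variable {n m l s : ℕ} {P : Measure (E m)} {α : ℝ} {C : E n → E m → E n}
  {A : Matrix (Fin l) (Fin n) ℝ} {q : Fin s → E n → ℝ} {Ω : Type*} {mΩ : MeasurableSpace Ω}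
  {μ : Measure Ω} {N : ℕ → ℕ} {ξ : (k : ℕ) → Fin (N k) → Ω → E m}

lemma measurable_batch_iSup {T : Set ((k : ℕ) × Fin (N k))} {k : ℕ} (hT : ∀ j, ⟨k, j⟩ ∈ T) :
    Measurable[⨆ p ∈ T, MeasurableSpace.comap (ξ p.1 p.2) inferInstance]
      fun ω j => ξ k j ω := by
  refine @measurable_pi_lambda _ _ _ (_) _ _ fun j => ?_
  exact (comap_measurable (ξ k j)).mono (le_biSup (fun p : (k : ℕ) × Fin (N k) =>
    MeasurableSpace.comap (ξ p.1 p.2) inferInstance) (hT j)) le_rfl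

/-- The history of the algorithm: the `k`-th σ-algebra is generated by the samples drawn strictly
before iteration `k`, so that the `k`-th iterate, but not the `k`-th batch, is measurable. -/
def sampleFiltration (hξ : ∀ k j, Measurable (ξ k j)) : Filtration ℕ mΩ where
  seq k := ⨆ p ∈ {p : (k : ℕ) × Fin (N k) | p.1 < k},
    MeasurableSpace.comap (ξ p.1 p.2) inferInstance
  mono' _ _ hij := biSup_mono fun _ hp => lt_of_lt_of_le hp hij
  le' _ := iSup₂_le fun p _ => (hξ p.1 p.2).comap_le

lemma measurable_batch_sampleFiltration (hξ : ∀ k j, Measurable (ξ k j)) (k : ℕ) :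
    Measurable[sampleFiltration hξ (k + 1)] fun ω j => ξ k j ω :=
  measurable_batch_iSup fun _ => Nat.lt_succ_self k

lemma indep_sampleFiltration_batch (hiid : IIDSamples μ P N ξ) (k : ℕ) :
    Indep (sampleFiltration hiid.1 k)
      (MeasurableSpace.comap (fun ω j => ξ k j ω) inferInstance) μ := by
  have hpast_present := indep_iSup_of_disjoint
    (m := fun p : (k : ℕ) × Fin (N k) => MeasurableSpace.comap (ξ p.1 p.2) inferInstance)
    (fun p => (hiid.1 p.1 p.2).comap_le) hiid.2.2 (S := {p | p.1 < k}) (T := {p | p.1 = k})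
    (Set.disjoint_left.2 fun _ hlt heq => hlt.ne heq)
  exact indep_of_indep_of_le_right hpast_present (measurable_batch_iSup fun _ => rfl).comap_le

lemma map_batch_eq_pi [IsProbabilityMeasure μ] (hiid : IIDSamples μ P N ξ) (k : ℕ) :
    μ.map (fun ω j => ξ k j ω) = Measure.pi fun _ : Fin (N k) => P := by
  have hindep : iIndepFun (fun j : Fin (N k) => ξ k j) μ :=
    hiid.2.2.precomp (g := Sigma.mk k) sigma_mk_injective
  rw [(iIndepFun_iff_map_fun_eq_pi_map fun j => (hiid.1 k j).aemeasurable).1 hindep]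
  simp only [hiid.2.1]

lemma measurable_subspaceIter (hα0 : 0 < α) (hα1 : α ≤ 1) (hC : Measurable (Function.uncurry C))
    (hF : Measurable (cvarMap P α C)) (hproj : Measurable (proj (ineqSet q)))
    (hξ : ∀ k j, Measurable (ξ k j)) (γ : ℕ → ℝ) (c : ℝ) (h0 : E n) (k : ℕ) :
    Measurable[sampleFiltration hξ k]
      fun ω => subspaceIter P α C A q γ c N (fun k j => ξ k j ω) h0 k := by
  induction k with
  | zero => exact measurable_const
  | succ k ih =>
    let step : E n × (Fin (N k) → E m) → E n := fun p => p.1 - γ k • kerProj A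
      (cvarMap P α C p.1 + c • (p.1 - proj (ineqSet q) p.1) + estError P α C p.2 p.1)
    have hstep : Measurable step :=
      measurable_fst.sub (((kerProj A).measurable.comp
        (((hF.comp measurable_fst).add
          ((measurable_fst.sub (hproj.comp measurable_fst)).const_smul c)).add
            (measurable_estError hα0 hα1 hC hF))).const_smul (γ k))
    exact hstep.comp ((ih.mono ((sampleFiltration hξ).mono k.le_succ) le_rfl).prodMk
      (measurable_batch_sampleFiltration hξ k))

variable [IsProbabilityMeasure μ] {h : ℕ → Ω → E n} {x : E n} {D B : ℝ}

lemma ae_exists_tendsto_sum_mul_inner_estError_sub_condExp (hα0 : 0 < α) (hα1 : α ≤ 1)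
    (hC : Measurable (Function.uncurry C)) (hF : Measurable (cvarMap P α C))
    (hξ : ∀ k j, Measurable (ξ k j)) (hh : ∀ k, Measurable[sampleFiltration hξ k] (h k))
    (hD : ∀ᵐ ω ∂μ, ∀ k, ‖h k ω - x‖ ≤ D)
    (hB : ∀ᵐ ω ∂μ, ∀ k, ‖estError P α C (fun j => ξ k j ω) (h k ω)‖ ≤ B)
    {γ : ℕ → ℝ} (hγ : Summable fun k => γ k ^ 2) :
    ∀ᵐ ω ∂μ, ∃ L, Tendsto (fun k => ∑ i ∈ Finset.range k,
      γ i * (inner ℝ (h i ω - x) (estError P α C (fun j => ξ i j ω) (h i ω))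
        - (μ[fun ω => inner ℝ (h i ω - x) (estError P α C (fun j => ξ i j ω) (h i ω))
            | sampleFiltration hξ i]) ω)) atTop (𝓝 L) := by
  refine ae_exists_tendsto_sum_mul_sub_condExp (ℱ := sampleFiltration hξ) (R := D * B)
    (X := fun k ω => inner ℝ (h k ω - x) (estError P α C (fun j => ξ k j ω) (h k ω)))
    (fun k => ?_) (fun k => ?_) hγ
  · have hhk : Measurable[sampleFiltration hξ (k + 1)] (h k) :=
      (hh k).mono ((sampleFiltration hξ).mono k.le_succ) le_rfl
    have hpair : Measurable[sampleFiltration hξ (k + 1)] fun ω => (h k ω, fun j => ξ k j ω) :=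
      hhk.prodMk (measurable_batch_sampleFiltration hξ k)
    exact ((measurable_inner_estError hα0 hα1 hC hF x).comp hpair).stronglyMeasurable
  · filter_upwards [hD, hB] with ω hDω hBω
    exact (abs_real_inner_le_norm _ _).trans
      (mul_le_mul (hDω k) (hBω k) (norm_nonneg _) ((norm_nonneg _).trans (hDω k)))

lemma ae_limsup_norm_subspaceIter_sub_le [IsProbabilityMeasure P] (hα0 : 0 < α) (hα1 : α ≤ 1)
    (hC : Measurable (Function.uncurry C)) (hF : Continuous (cvarMap P α C))
    (hproj : Continuous (proj (ineqSet q))) {b : E l} (hx : x ∈ affSet A b)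
    {γ : ℕ → ℝ} (hγ : IsStepSize γ) {h0 : E n} (hh0 : h0 ∈ affSet A b)
    (hiid : IIDSamples μ P N ξ) {c ε δ R B : ℝ} (hε : 0 < ε) (hδ : 0 < δ)
    (hdrift : ∀ y ∈ affSet A b, ‖y‖ ≤ R → ε ≤ ‖y - x‖ →
      δ ≤ inner ℝ (y - x) (cvarMap P α C y + c • (y - proj (ineqSet q) y)))
    (hN : ∀ k, 0 < N k ∧ (R + ‖x‖) * (n * (B / (α * √(N k)))) ≤ δ / 2)
    (hR : ∀ᵐ ω ∂μ, ∀ k, ‖subspaceIter P α C A q γ c N (fun k j => ξ k j ω) h0 k‖ ≤ R)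
    (hB : ∀ᵐ ω ∂μ, ∀ k, ‖estError P α C (fun j => ξ k j ω)
      (subspaceIter P α C A q γ c N (fun k j => ξ k j ω) h0 k)‖ ≤ B) :
    ∀ᵐ ω ∂μ, limsup (fun k =>
      ‖subspaceIter P α C A q γ c N (fun k j => ξ k j ω) h0 k - x‖) atTop ≤ ε := by
  have (k : ℕ) : NeZero (N k) := ⟨(hN k).1.ne'⟩
  let h (k : ℕ) (ω : Ω) : E n := subspaceIter P α C A q γ c N (fun k j => ξ k j ω) h0 k
  let β (k : ℕ) (ω : Ω) : E n := estError P α C (fun j => ξ k j ω) (h k ω)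
  let g (y : E n) : E n := cvarMap P α C y + c • (y - proj (ineqSet q) y)
  let bias (k : ℕ) : Ω → ℝ := μ[fun ω => inner ℝ (h k ω - x) (β k ω) | sampleFiltration hiid.1 k]
  have hh (k : ℕ) : Measurable[sampleFiltration hiid.1 k] (h k) :=
    measurable_subspaceIter hα0 hα1 hC hF.measurable hproj.measurable hiid.1 γ c h0 k
  have hD : ∀ᵐ ω ∂μ, ∀ k, ‖h k ω - x‖ ≤ R + ‖x‖ :=
    hR.mono fun ω hω k => (norm_sub_le _ _).trans (by gcongr; exact hω k)
  have hbias : ∀ᵐ ω ∂μ, ∀ k, |bias k ω| ≤ δ / 2 := ae_all_iff.2 fun k =>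
    (ae_abs_condExp_inner_estError_le hα0 hα1 hC hF.measurable ((sampleFiltration hiid.1).le k)
      (hh k) (measurable_pi_lambda _ (hiid.1 k)) (indep_sampleFiltration_batch hiid k)
      (map_batch_eq_pi hiid k) (ae_all_iff.1 hD k) (ae_all_iff.1 hB k)).mono
        fun ω hω => hω.trans (hN k).2
  obtain ⟨G, hG⟩ : ∃ G, ∀ y ∈ Metric.closedBall (0 : E n) R, ‖g y‖ ≤ G :=
    (isCompact_closedBall _ _).exists_bound_of_continuousOn
      (hF.add ((continuous_id.sub hproj).const_smul c)).continuousOn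
  filter_upwards [hR, hB, hD, hbias, ae_exists_tendsto_sum_mul_inner_estError_sub_condExp hα0 hα1
    hC hF.measurable hiid.1 hh hD hB hγ.2.2] with ω hRω hBω hDω hbiasω ⟨L, hL⟩
  have hmem (k : ℕ) : h k ω ∈ affSet A b := subspaceIter_mem_affSet _ hh0 k
  have hGω (k : ℕ) : ‖g (h k ω)‖ ≤ G := hG _ (mem_closedBall_zero_iff.2 (hRω k))
  refine limsup_norm_sub_le_of_robbinsMonro (w := fun k => g (h k ω) + β k ω)
    (a := fun k => inner ℝ (h k ω - x) (g (h k ω)) + bias k ω) (M := (R + ‖x‖) * G + δ / 2)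
    (L := L) (R := G + B) (δ := δ / 2) hγ (fun k => rfl) (fun k => sub_mem_ker (hmem k) hx)
    (fun k => norm_add_le_of_le (hGω k) (hBω k)) (fun k => ?_) hε (half_pos hδ)
    (fun k hk => ?_) ?_
  · have hinner : |inner ℝ (h k ω - x) (g (h k ω))| ≤ (R + ‖x‖) * G :=
      (abs_real_inner_le_norm _ _).trans
        (mul_le_mul (hDω k) (hGω k) (norm_nonneg _) ((norm_nonneg _).trans (hDω k)))
    linarith [(abs_le.1 hinner).1, (abs_le.1 (hbiasω k)).1]
  · linarith [hdrift _ (hmem k) (hRω k) hk, (abs_le.1 (hbiasω k)).1]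
  · refine hL.congr fun k => Finset.sum_congr rfl fun i _ => ?_
    rw [← add_sub_add_left_eq_sub, inner_add_right]

end Algorithm

end CVaRVI

open CVaRVI in
theorem proposition2_general {n m l s : ℕ}
    (P : Measure (E m)) [IsProbabilityMeasure P]
    (α : ℝ) (hα0 : 0 < α) (hα1 : α ≤ 1)
    (C : E n → E m → E n) (hC : Measurable (Function.uncurry C))
    (hFcont : Continuous (cvarMap P α C))
    (A : Matrix (Fin l) (Fin n) ℝ) (b : E l) (q : Fin s → E n → ℝ)
    (hqconv : ∀ i, ConvexOn ℝ Set.univ (q i))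
    (hstar : E n)
    (hminty : IsStrictMintySolution (feasSet A b q) (cvarMap P α C) hstar) :
    (∀ (γ : ℕ → ℝ) (c : ℝ) (N : ℕ → ℕ) (x : (k : ℕ) → Fin (N k) → E m),
      ∀ h0 ∈ affSet A b, ∀ k,
        subspaceIter P α C A q γ c N x h0 k ∈ affSet A b) ∧
    ∀ ε : ℝ, 0 < ε → ∀ Btraj : ℝ, ∃ cε : ℝ, 0 < cε ∧ ∀ Berr : ℝ, ∃ Nε : ℕ,
      ∀ (γ : ℕ → ℝ) (c : ℝ) (N : ℕ → ℕ) (h0 : E n)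
        (Ω : Type*) [MeasurableSpace Ω] (μ : Measure Ω) [IsProbabilityMeasure μ]
        (ξ : (k : ℕ) → Fin (N k) → Ω → E m),
        IsStepSize γ → h0 ∈ affSet A b → IIDSamples μ P N ξ →
        cε ≤ c → (∀ k, Nε ≤ N k) →
        (∀ᵐ ω ∂μ, ∀ k,
          ‖subspaceIter P α C A q γ c N (fun k j => ξ k j ω) h0 k‖ ≤ Btraj) →
        (∀ᵐ ω ∂μ, ∀ k,
          ‖estError P α C (fun j => ξ k j ω)
            (subspaceIter P α C A q γ c N (fun k j => ξ k j ω) h0 k)‖ ≤ Berr) →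
        ∀ᵐ ω ∂μ,
          limsup (fun k =>
            ‖subspaceIter P α C A q γ c N (fun k j => ξ k j ω) h0 k - hstar‖) atTop ≤ ε := by
  have hproj : Continuous (proj (ineqSet q)) :=
    (lipschitzWith_proj ⟨hstar, hminty.1.2⟩ (isClosed_ineqSet hqconv)
      (convex_ineqSet hqconv)).continuous
  refine ⟨fun γ c N x h0 hh0 k => subspaceIter_mem_affSet x hh0 k, fun ε hε Btraj => ?_⟩
  obtain ⟨cε, hcε, δ, hδ, hdrift⟩ := hminty.exists_penalty_inner_ge hFcont hqconv hε Btraj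
  refine ⟨cε, hcε, fun Berr => ?_⟩
  obtain ⟨Nε, hNε⟩ :=
    exists_forall_ge_mul_div_sqrt_le ((Btraj + ‖hstar‖) * n) Berr α (half_pos hδ)
  refine ⟨Nε, fun γ c N h0 Ω _ μ _ ξ hγ hh0 hiid hc hN htraj herr => ?_⟩
  exact ae_limsup_norm_subspaceIter_sub_le hα0 hα1 hC hFcont hproj hminty.1.1 hγ hh0 hiid hε hδ
    (hdrift c hc) (fun k => by simpa only [mul_assoc] using hNε (N k) (hN k)) htraj herr

theorem proposition2 {n m l s : ℕ}
    -- the random cost, its law, the risk level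
    (P : Measure (CVaRVI.E m)) [IsProbabilityMeasure P]
    (α : ℝ) (hα0 : 0 < α) (hα1 : α ≤ 1)
    (C : CVaRVI.E n → CVaRVI.E m → CVaRVI.E n) (hC : Measurable (Function.uncurry C))
    (hFcont : Continuous (CVaRVI.cvarMap P α C))
    (hFmono : CVaRVI.StrictlyMonotone (CVaRVI.cvarMap P α C))
    -- the feasible set
    (A : Matrix (Fin l) (Fin n) ℝ) (b : CVaRVI.E l) (q : Fin s → CVaRVI.E n → ℝ)
    (hqconv : ∀ i, ConvexOn ℝ Set.univ (q i)) (hqdiff : ∀ i, ContDiff ℝ 1 (q i))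
    (hcompact : IsCompact (CVaRVI.feasSet A b q))
    -- the solution of the variational inequality
    (hstar : CVaRVI.E n)
    (hsol : hstar ∈ CVaRVI.SOL (CVaRVI.feasSet A b q) (CVaRVI.cvarMap P α C)) :
    -- the iterates stay in the affine set
    (∀ (γ : ℕ → ℝ) (c : ℝ) (N : ℕ → ℕ) (x : (k : ℕ) → Fin (N k) → CVaRVI.E m),
      ∀ h0 ∈ CVaRVI.affSet A b, ∀ k,
        CVaRVI.subspaceIter P α C A q γ c N x h0 k ∈ CVaRVI.affSet A b) ∧
    -- convergence to the `ε`-neighbourhood of the solution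
    ∀ ε : ℝ, 0 < ε → ∀ Btraj : ℝ, ∃ cε : ℝ, 0 < cε ∧ ∀ Berr : ℝ, ∃ Nε : ℕ,
      ∀ (γ : ℕ → ℝ) (c : ℝ) (N : ℕ → ℕ) (h0 : CVaRVI.E n)
        (Ω : Type*) [MeasurableSpace Ω] (μ : Measure Ω) [IsProbabilityMeasure μ]
        (ξ : (k : ℕ) → Fin (N k) → Ω → CVaRVI.E m),
        CVaRVI.IsStepSize γ → h0 ∈ CVaRVI.affSet A b → CVaRVI.IIDSamples μ P N ξ →
        cε ≤ c → (∀ k, Nε ≤ N k) →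
        (∀ᵐ ω ∂μ, ∀ k,
          ‖CVaRVI.subspaceIter P α C A q γ c N (fun k j => ξ k j ω) h0 k‖ ≤ Btraj) →
        (∀ᵐ ω ∂μ, ∀ k,
          ‖CVaRVI.estError P α C (fun j => ξ k j ω)
            (CVaRVI.subspaceIter P α C A q γ c N (fun k j => ξ k j ω) h0 k)‖ ≤ Berr) →
        ∀ᵐ ω ∂μ,
          limsup (fun k =>
            ‖CVaRVI.subspaceIter P α C A q γ c N (fun k j => ξ k j ω) h0 k - hstar‖) atTop ≤ ε :=
  proposition2_general P α hα0 hα1 C hC hFcont A b q hqconv hstar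
    (hFmono.isStrictMintySolution hsol)
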